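/- Let $q>1$ and let $\chi$ be a real primitive Dirichlet character modulo $q$ such that $L(s,\chi)\neq 0$ for all real $s$ with $0<s<1$. For real $s>1$ put $F(s,\chi)=\log L(s,\chi)$ and, for $k\ge 1$, let $A_{\chi,k}=\{s>1: F^{(k)}(s,\chi)=0\}$. Then there is a constant $c_\chi\ge 1$, depending only on $\chi$, such that $[c_\chi,\infty)\cap\bigcup_{k=1}^{\infty}A_{\chi,k}$ is dense in $[c_\chi,\infty)$. In particular, $L(s,\chi)$ is not logarithmically completely monotonic on any subinterval of $[c_\chi,\infty)$ with more than one point. Here a function $f$ is called logarithmically completely monotonic on an interval $I$ if it is positive and $C^\infty$ on $I$ and $(-1)^k(\log f)^{(k)}(x)\ge 0$ for all $x\in I$ and all $k\ge 1$ (so $L(s,\chi)$ is, a fortiori, not logarithmically completely monotonic if the inequality is also required for $k=0$). -/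

import Mathlib

open scoped ContDiff

/-- `f` is logarithmically completely monotonic on `I`: it is positive and smooth on `I`, and
`(-1) ^ k * (log f)^(k) ≥ 0` on `I` for all `k ≥ 1`. Some authors demand the inequality for
`k = 0` too, which gives a smaller class of functions; failing the present condition is the
stronger assertion. -/
def LogCompletelyMonotonicOn (f : ℝ → ℝ) (I : Set ℝ) : Prop :=
  ContDiffOn ℝ ∞ f I ∧ (∀ x ∈ I, 0 < f x) ∧
    ∀ k : ℕ, 1 ≤ k → ∀ x ∈ I,
      0 ≤ (-1 : ℝ) ^ k * iteratedDerivWithin k (fun t => Real.log (f t)) I x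

namespace DirichletCharacter

/-- The character takes only real values. -/
def IsReal {q : ℕ} (χ : DirichletCharacter ℂ q) : Prop :=
  ∀ a : ZMod q, (χ a).im = 0

/-- `s ↦ L(s, χ)` as a real function of a real variable; for a real character the value
`L(s, χ)` at a real point is real, so that taking the real part loses nothing. -/
noncomputable def realL {q : ℕ} [NeZero q] (χ : DirichletCharacter ℂ q) (s : ℝ) : ℝ :=
  (χ.LFunction (s : ℂ)).re

/-- `F(s, χ) = log L(s, χ)`. -/
noncomputable def logL {q : ℕ} [NeZero q] (χ : DirichletCharacter ℂ q) (s : ℝ) : ℝ :=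
  Real.log (χ.realL s)

/-- The real points `s > 1` at which the `k`-th derivative of `F(s, χ)` vanishes. -/
def logLDerivZeros {q : ℕ} [NeZero q] (χ : DirichletCharacter ℂ q) (k : ℕ) : Set ℝ :=
  {s : ℝ | 1 < s ∧ iteratedDeriv k χ.logL s = 0}

end DirichletCharacter

/-! High derivatives of `L'/L` at a real point `x` are governed by the zeros of `L` nearest to `x`.
If these are a nonreal `ρ` and possibly its conjugate, the `n`-th derivative is, up to a positive
factor and a relatively small error, `(-1)^n n! |x - ρ|^(-n-1) cos((n+1) arg(x - ρ))`. As `arg(x -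
ρ)` varies with `x`, for large `n` the cosine attains both `1` and `-1` on any given short interval
(`Complex.exists_re_iteratedDeriv_pos_neg`). Other ties for the nearest zero occur at only countably
many `x` (`countable_setOf_dist_eq`). Far to the right the nearest zero has positive real part,
which excludes the trivial zeros, so it is nonreal by the hypothesis on `(0, 1)`. The sign changes
yield zeros of the derivatives and rule out monotonicity.

This needs some zero with positive real part (`IsPrimitive.exists_LFunction_eq_zero`). Without one,
the functional equation makes the completed `L`-function zero-free; being of growth `exp(O(r log
r))`, it is then `exp(a + b s)`. But `L(x)` tends to `1` while the Gamma factor outgrows every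
exponential. -/

/-! ### Zero-free entire functions of slow growth -/

section ZeroFree

open Filter Topology Complex

/-- An entire function without zeros is the exponential of an entire function. -/
lemma Complex.exists_eq_exp_of_ne_zero {f : ℂ → ℂ} (hf : Differentiable ℂ f)
    (h0 : ∀ z, f z ≠ 0) :
    ∃ g : ℂ → ℂ, Differentiable ℂ g ∧ ∀ z, f z = exp (g z) := by
  have hf' : Differentiable ℂ (deriv f) := fun z =>
    (hf.analyticAt z).deriv.differentiableAt
  obtain ⟨g, hg0, hg⟩ := (hf'.div hf h0).isExactOn_univ.with_val_at 0 (log (f 0))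
  replace hg : ∀ z, HasDerivAt g (deriv f z / f z) z := fun z => hg z (Set.mem_univ z)
  have hgd : Differentiable ℂ g := fun z => (hg z).differentiableAt
  refine ⟨g, hgd, fun z => ?_⟩
  have key : ∀ z, HasDerivAt (fun z => f z * exp (-g z)) 0 z := fun z => by
    refine ((hf z).hasDerivAt.mul ((hg z).fun_neg.cexp)).congr_deriv ?_
    linear_combination -exp (-g z) * mul_div_cancel₀ (deriv f z) (h0 z)
  have hc := is_const_of_deriv_eq_zero (fun z => (key z).differentiableAt)
    (fun z => (key z).deriv) z 0
  simp only [hg0, exp_neg, exp_log (h0 0), mul_inv_cancel₀ (h0 0)] at hc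
  rwa [mul_inv_eq_one₀ (exp_ne_zero _)] at hc

/-- A zero-free entire function of growth `exp (o(r ^ 2))` is the exponential of an affine
function. -/
lemma Complex.eq_exp_affine_of_growth {f : ℂ → ℂ} (hf : Differentiable ℂ f)
    (h0 : ∀ z, f z ≠ 0) {M : ℕ → ℝ}
    (hM : ∀ n : ℕ, 1 ≤ n → ∀ z : ℂ, ‖z‖ < n → ‖f z‖ ≤ Real.exp (M n))
    (hlim : Tendsto (fun n : ℕ => M n / (n : ℝ) ^ 2) atTop (𝓝 0)) :
    ∃ a b : ℂ, ∀ z, f z = exp (a + b * z) := by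
  obtain ⟨g, hg, hfg⟩ := exists_eq_exp_of_ne_zero hf h0
  have hg2 : ∀ c, iteratedDeriv 2 g c = 0 := by
    intro c
    have hbound : ∀ᶠ n : ℕ in atTop,
        ‖iteratedDeriv 2 g c‖ ≤ 64 * |M n / (n : ℝ) ^ 2| + (64 + 96 * ‖g 0‖) / (n : ℝ) ^ 2 := by
      filter_upwards [(tendsto_natCast_atTop_atTop (R := ℝ)).eventually_ge_atTop (4 * ‖c‖),
        eventually_ge_atTop 1] with n hn hn1
      have hn0 : (0 : ℝ) < n := by exact_mod_cast hn1
      have hre : Set.MapsTo g (Metric.ball 0 n) {z | z.re ≤ |M n| + 1} := fun z hz => by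
        have := hM n hn1 z (mem_ball_zero_iff.mp hz)
        rw [hfg z, norm_exp, Real.exp_le_exp] at this
        exact this.trans (by linarith [le_abs_self (M n)])
      have hsph : ∀ z ∈ Metric.sphere c (n / 4 : ℝ), ‖g z‖ ≤ 2 * (|M n| + 1) + 3 * ‖g 0‖ := by
        intro z hz
        have hz' : ‖z‖ ≤ n / 2 := by
          have h1 : ‖z - c‖ = n / 4 := mem_sphere_iff_norm.mp hz
          have h2 := norm_add_le (z - c) c
          rw [sub_add_cancel] at h2
          linarith
        have hd : (n : ℝ) / 2 ≤ n - ‖z‖ := by linarith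
        have hd0 : 0 < (n : ℝ) - ‖z‖ := by linarith
        refine (borelCaratheodory (by positivity) hg.differentiableOn hre hn0
          (mem_ball_zero_iff.mpr (by linarith))).trans (add_le_add ?_ ?_)
        · rw [div_le_iff₀ hd0]
          exact mul_le_mul_of_nonneg_left (by linarith) (by positivity)
        · rw [div_le_iff₀ hd0, mul_comm 3, mul_assoc]
          exact mul_le_mul_of_nonneg_left (by linarith) (by positivity)
      refine (norm_iteratedDeriv_le_of_forall_mem_sphere_norm_le 2 (by positivity)
        hg.diffContOnCl hsph).trans (le_of_eq ?_)
      rw [abs_div, abs_of_pos (by positivity : 0 < (n : ℝ) ^ 2)]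
      norm_num [Nat.factorial]
      field_simp
      ring
    have hz : Tendsto (fun n : ℕ => 64 * |M n / (n : ℝ) ^ 2| + (64 + 96 * ‖g 0‖) / (n : ℝ) ^ 2)
        atTop (𝓝 (64 * |0| + 0)) :=
      (hlim.abs.const_mul 64).add (tendsto_const_nhds.div_atTop
        ((tendsto_pow_atTop two_ne_zero).comp tendsto_natCast_atTop_atTop))
    have := ge_of_tendsto hz hbound
    simpa using this
  have hg' : Differentiable ℂ (deriv g) := fun z => (hg.analyticAt z).deriv.differentiableAt
  have hconst : ∀ z, deriv g z = deriv g 0 := fun z =>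
    is_const_of_deriv_eq_zero hg' (fun w => by
      simpa [iteratedDeriv_succ] using hg2 w) z 0
  refine ⟨g 0, deriv g 0, fun z => ?_⟩
  have hlin := is_const_of_deriv_eq_zero (f := fun w => g w - deriv g 0 * w)
    (by fun_prop) (fun w => by
      have h := ((hg w).hasDerivAt.sub ((hasDerivAt_id w).const_mul (deriv g 0))).deriv
      rw [hconst w, mul_one, sub_self] at h
      exact h) z 0
  rw [hfg z]
  congr 1
  simp only [mul_zero, sub_zero] at hlin
  rw [← hlin]
  ring

end ZeroFree

/-! ### Bounds for the completed `L`-function -/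

section Growth

open Filter Topology Complex MeasureTheory Set

/-- On the strip, `t ^ (σ - 1)` is at most `t ^ (a - 1)` for `t ≤ 1` and at most `t ^ (b - 1)` for
`t ≥ 1`, so the sum of the two endpoint integrands dominates. -/
lemma norm_mellin_le_of_mem_strip {f : ℝ → ℂ} {a b : ℝ} (ha : MellinConvergent f a)
    (hb : MellinConvergent f b) :
    ∃ C, ∀ s : ℂ, a ≤ s.re → s.re ≤ b → ‖mellin f s‖ ≤ C := by
  refine ⟨∫ t in Ioi (0 : ℝ), (‖(t : ℂ) ^ ((a : ℂ) - 1) • f t‖ + ‖(t : ℂ) ^ ((b : ℂ) - 1) • f t‖),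
    fun s h1 h2 => ?_⟩
  refine norm_integral_le_of_norm_le (Integrable.add ha.norm hb.norm) ?_
  filter_upwards [ae_restrict_mem measurableSet_Ioi] with t (ht : 0 < t)
  simp only [norm_smul, norm_cpow_eq_rpow_re_of_pos ht, sub_re, ofReal_re, one_re, ← add_mul]
  refine mul_le_mul_of_nonneg_right ?_ (norm_nonneg _)
  rcases le_total t 1 with h | h
  · exact (Real.rpow_le_rpow_of_exponent_ge ht h (by linarith)).trans
      (le_add_of_nonneg_right (by positivity))
  · exact (Real.rpow_le_rpow_of_exponent_le h (by linarith)).trans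
      (le_add_of_nonneg_left (by positivity))

lemma WeakFEPair.exists_norm_Λ₀_le (P : WeakFEPair ℂ) (a b : ℝ) :
    ∃ C, ∀ s : ℂ, a ≤ s.re → s.re ≤ b → ‖P.Λ₀ s‖ ≤ C :=
  norm_mellin_le_of_mem_strip (P.isStrongFEPair_toStrongFEPair.hasMellin a).1
    (P.isStrongFEPair_toStrongFEPair.hasMellin b).1

lemma Complex.norm_Gamma_le {s : ℂ} (hs : 0 < s.re) : ‖Gamma s‖ ≤ Real.Gamma s.re := by
  rw [Gamma_eq_integral hs, Real.Gamma_eq_integral hs, GammaIntegral]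
  refine norm_integral_le_of_norm_le (Real.GammaIntegral_convergent hs) ?_
  filter_upwards [ae_restrict_mem measurableSet_Ioi] with t (ht : 0 < t)
  simp [norm_cpow_eq_rpow_re_of_pos ht, -ofReal_exp, norm_real]

/-- Convexity bounds `Γ` on `[1, n + 1]` by its larger endpoint value. -/
lemma Real.Gamma_le_factorial {x : ℝ} {n : ℕ} (hx : 1 ≤ x) (hn : x ≤ n) :
    Real.Gamma x ≤ n.factorial := by
  have hn1 : (1 : ℝ) ≤ n := hx.trans hn
  have h := Real.convexOn_Gamma.le_max_of_mem_Icc (x := 1) (y := (n : ℝ) + 1)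
    (by simp) (by simp only [mem_Ioi]; positivity) (z := x) ⟨hx, by linarith⟩
  rw [Real.Gamma_one, Real.Gamma_nat_eq_factorial] at h
  refine h.trans (max_le ?_ le_rfl)
  exact_mod_cast n.factorial_pos

lemma Complex.norm_Gammaℝ_le {s : ℂ} {n : ℕ} (hs : 2 ≤ s.re) (hn : s.re ≤ 2 * n) :
    ‖Gammaℝ s‖ ≤ n.factorial := by
  have hre : (s / 2).re = s.re / 2 := by simp
  rw [Gammaℝ_def, norm_mul, norm_cpow_eq_rpow_re_of_pos Real.pi_pos]
  have h1 : Real.pi ^ (-s / 2).re ≤ 1 := by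
    refine Real.rpow_le_one_of_one_le_of_nonpos (by linarith [Real.pi_gt_three]) ?_
    simp; linarith
  have h2 : ‖Gamma (s / 2)‖ ≤ n.factorial :=
    (norm_Gamma_le (by rw [hre]; linarith)).trans
      (Real.Gamma_le_factorial (by rw [hre]; linarith) (by rw [hre]; linarith))
  calc _ ≤ 1 * (n.factorial : ℝ) := mul_le_mul h1 h2 (norm_nonneg _) zero_le_one
    _ = _ := one_mul _

namespace DirichletCharacter
variable {q : ℕ} [NeZero q] {χ : DirichletCharacter ℂ q}

lemma exists_norm_LFunction_le (χ : DirichletCharacter ℂ q) :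
    ∃ C, 0 ≤ C ∧ ∀ s : ℂ, 2 ≤ s.re → ‖χ.LFunction s‖ ≤ C := by
  refine ⟨∑' n, ‖LSeries.term (χ ·) 2 n‖, tsum_nonneg fun _ => norm_nonneg _, fun s hs => ?_⟩
  rw [LFunction_eq_LSeries χ (by linarith), LSeries]
  have h2 : Summable fun n => ‖LSeries.term (χ ·) 2 n‖ :=
    (LSeriesSummable_of_one_lt_re χ (s := 2) (by simp)).norm
  have hle := LSeries.norm_term_le_of_re_le_re (s := 2) (s' := s) (χ ·) (by simpa using hs)
  have hs' := Summable.of_nonneg_of_le (fun _ => norm_nonneg _) hle h2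
  exact (norm_tsum_le_tsum_norm hs').trans (hs'.tsum_le_tsum hle h2)

lemma exists_gammaFactor_eq {N : ℕ} (χ : DirichletCharacter ℂ N) :
    ∃ δ : ℕ, δ ≤ 1 ∧ ∀ s, χ.gammaFactor s = Gammaℝ (s + δ) := by
  rcases χ.even_or_odd with h | h
  · exact ⟨0, by simp, fun s => by simp [h.gammaFactor_def]⟩
  · exact ⟨1, by simp, fun s => by simp [h.gammaFactor_def]⟩

lemma completedLFunction_eq_mul (χ : DirichletCharacter ℂ q) {s : ℂ} (hs : 0 < s.re) :
    χ.completedLFunction s = χ.LFunction s * χ.gammaFactor s := by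
  obtain ⟨δ, -, hδ⟩ := exists_gammaFactor_eq χ
  have : χ.gammaFactor s ≠ 0 := by
    rw [hδ]
    exact Gammaℝ_ne_zero_of_re_pos (by simp; positivity)
  rw [LFunction_eq_completed_div_gammaFactor χ s (.inl (by rintro rfl; simp at hs)),
    div_mul_cancel₀ _ this]

/-- The completed `L`-function of a nontrivial character is bounded in vertical strips. -/
lemma exists_norm_completedLFunction_le (hχ : χ ≠ 1) (a b : ℝ) :
    ∃ C, ∀ s : ℂ, a ≤ s.re → s.re ≤ b → ‖χ.completedLFunction s‖ ≤ C := by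
  have hq : q ≠ 1 := hχ ∘ level_one' _
  choose E hE using fun j : ZMod q =>
    (HurwitzZeta.hurwitzEvenFEPair (ZMod.toAddCircle j)).exists_norm_Λ₀_le (a / 2) (b / 2)
  choose O hO using fun j : ZMod q =>
    (HurwitzZeta.hurwitzOddFEPair (ZMod.toAddCircle j)).exists_norm_Λ₀_le ((a + 1) / 2) ((b + 1) / 2)
  -- The odd pair has no constant terms at either end, so `Λ` and `Λ₀` agree.
  have hodd (j : ZMod q) (s : ℂ) : HurwitzZeta.completedHurwitzZetaOdd (ZMod.toAddCircle j) s =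
      (HurwitzZeta.hurwitzOddFEPair (ZMod.toAddCircle j)).Λ₀ ((s + 1) / 2) / 2 := by
    rw [HurwitzZeta.completedHurwitzZetaOdd, WeakFEPair.Λ₀_eq,
      (HurwitzZeta.isStrong_hurwitzOddFEPair _).hf₀, (HurwitzZeta.isStrong_hurwitzOddFEPair _).hg₀]
    simp
  refine ⟨(q : ℝ) ^ (-a) * ∑ j, ‖χ j‖ * (E j / 2) + (q : ℝ) ^ (-a) * ∑ j, ‖χ j‖ * (O j / 2),
    fun s h1 h2 => ?_⟩
  have hqs : ‖(q : ℂ) ^ (-s)‖ ≤ (q : ℝ) ^ (-a) := by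
    rw [norm_natCast_cpow_of_pos (NeZero.pos q)]
    exact Real.rpow_le_rpow_of_exponent_le (by exact_mod_cast NeZero.one_le) (by simpa using h1)
  -- The polar terms carry the factors `χ 0` and `∑ χ j`, both zero here.
  rw [completedLFunction, ZMod.completedLFunction_eq, χ.map_zero' hq, χ.sum_eq_zero_of_ne_one hχ]
  simp only [mul_zero, zero_div, sub_zero, ZMod.completedLFunction₀]
  refine (norm_add_le _ _).trans (add_le_add ?_ ?_) <;>
  · rw [norm_mul]
    refine mul_le_mul hqs ((norm_sum_le _ _).trans (Finset.sum_le_sum fun j _ => ?_))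
      (norm_nonneg _) (by positivity)
    rw [norm_mul]
    refine mul_le_mul_of_nonneg_left ?_ (norm_nonneg _)
    simp only [HurwitzZeta.completedHurwitzZetaEven₀, hodd, norm_div, norm_ofNat]
    gcongr
    first
    | exact hE j _ (by rw [div_ofNat_re]; linarith) (by rw [div_ofNat_re]; linarith)
    | exact hO j _ (by rw [div_ofNat_re, add_re, one_re]; linarith)
        (by rw [div_ofNat_re, add_re, one_re]; linarith)

lemma IsReal.inv_eq {N : ℕ} {χ : DirichletCharacter ℂ N} (h : χ.IsReal) : χ⁻¹ = χ := by
  rw [← MulChar.star_eq_inv]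
  ext a
  rw [MulChar.star_apply]
  exact conj_eq_iff_im.mpr (h a)

lemma exists_norm_completedLFunction_le_factorial (χ : DirichletCharacter ℂ q) :
    ∃ C, 0 ≤ C ∧ ∀ (n : ℕ) (s : ℂ), 2 ≤ s.re → ‖s‖ ≤ n →
      ‖χ.completedLFunction s‖ ≤ C * n.factorial := by
  obtain ⟨C, hC0, hC⟩ := exists_norm_LFunction_le χ
  obtain ⟨δ, hδ1, hδ⟩ := exists_gammaFactor_eq χ
  refine ⟨C, hC0, fun n s hs hn => ?_⟩
  have hn' := (re_le_norm s).trans hn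
  have hδ' : (δ : ℝ) ≤ 1 := by exact_mod_cast hδ1
  rw [completedLFunction_eq_mul χ (by linarith), norm_mul, hδ]
  refine mul_le_mul (hC s hs) (norm_Gammaℝ_le ?_ ?_) (norm_nonneg _) hC0
  · simp; linarith
  · simp; linarith

end DirichletCharacter

end Growth

/-! ### Existence of a zero in the right half-plane -/

section NonrealZero

open Filter Topology Complex

lemma norm_Gammaℝ_two_mul_nat_add_one (m : ℕ) :
    ‖Gammaℝ (2 * (m + 1))‖ = m.factorial / Real.pi ^ (m + 1) := by
  have h : (2 * ((m : ℂ) + 1)) / 2 = m + 1 := by ring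
  rw [Gammaℝ_def, norm_mul, norm_cpow_eq_rpow_re_of_pos Real.pi_pos, neg_div, h,
    Gamma_nat_eq_factorial, norm_natCast]
  have : (-((m : ℂ) + 1)).re = -((m + 1 : ℕ) : ℝ) := by simp [add_comm]
  rw [this, Real.rpow_neg Real.pi_pos.le, Real.rpow_natCast]
  field_simp

lemma tendsto_mul_log_div_sq (A B : ℝ) :
    Tendsto (fun n : ℕ => (A + (n + 2) * B + (n + 1) * Real.log (n + 1)) / (n : ℝ) ^ 2)
      atTop (𝓝 0) := by
  have hn : Tendsto (fun n : ℕ => (n : ℝ)) atTop atTop := tendsto_natCast_atTop_atTop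
  have hinv : Tendsto (fun n : ℕ => (n : ℝ)⁻¹) atTop (𝓝 0) := tendsto_inv_atTop_zero.comp hn
  have hlog : Tendsto (fun n : ℕ => Real.log (n + 1) / (n + 1 : ℝ)) atTop (𝓝 0) :=
    Real.isLittleO_log_id_atTop.tendsto_div_nhds_zero.comp (tendsto_atTop_add_const_right _ 1 hn)
  have h : Tendsto (fun n : ℕ => A * ((n : ℝ)⁻¹ * (n : ℝ)⁻¹) + ((n : ℝ)⁻¹ + 2 * ((n : ℝ)⁻¹ *
      (n : ℝ)⁻¹)) * B + (1 + (n : ℝ)⁻¹) * (1 + (n : ℝ)⁻¹) * (Real.log (n + 1) / (n + 1 : ℝ)))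
      atTop (𝓝 (A * (0 * 0) + (0 + 2 * (0 * 0)) * B + (1 + 0) * (1 + 0) * 0)) :=
    (((hinv.mul hinv).const_mul A).add ((hinv.add ((hinv.mul hinv).const_mul 2)).mul_const B)).add
      (((hinv.const_add 1).mul (hinv.const_add 1)).mul hlog)
  simp only [mul_zero, zero_mul, add_zero] at h
  refine h.congr' ?_
  filter_upwards [eventually_ge_atTop 1] with n hn1
  have : (n : ℝ) ≠ 0 := by positivity
  field_simp

namespace DirichletCharacter
variable {q : ℕ} [NeZero q] {χ : DirichletCharacter ℂ q}

lemma IsPrimitive.ne_one (hprim : χ.IsPrimitive) (hq : q ≠ 1) : χ ≠ 1 := by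
  rintro rfl
  exact hq (hprim.symm.trans conductor_one)

/-- The growth bound `exp (O(r log r))` for the completed `L`-function. -/
lemma IsPrimitive.exists_norm_completedLFunction_le_exp (hprim : χ.IsPrimitive) (hq : q ≠ 1) :
    ∃ A : ℝ, ∀ n : ℕ, 1 ≤ n → ∀ s : ℂ, ‖s‖ < n → ‖χ.completedLFunction s‖ ≤
      Real.exp (A + (n + 2) * Real.log q + (n + 1) * Real.log (n + 1)) := by
  obtain ⟨C, hC0, hC⟩ := exists_norm_completedLFunction_le_factorial χ
  obtain ⟨C', hC0', hC'⟩ := exists_norm_completedLFunction_le_factorial χ⁻¹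
  obtain ⟨D, hD⟩ := exists_norm_completedLFunction_le (hprim.ne_one hq) (-1) 2
  have hq1 : (1 : ℝ) ≤ q := by exact_mod_cast NeZero.one_le
  -- `K` dominates the constants of the three regions `Re s ≥ 2`, `-1 ≤ Re s ≤ 2` and `Re s ≤ -1`;
  -- the `1` makes `log K` usable.
  set K := C + |D| + ‖χ.rootNumber‖ * C' + 1 with hK
  have hK0 : 0 < K := by positivity
  refine ⟨Real.log K, fun n hn1 s hs => ?_⟩
  have hfac : ((n + 1).factorial : ℝ) ≤ ((n : ℝ) + 1) ^ (n + 1) := by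
    exact_mod_cast Nat.factorial_le_pow (n + 1)
  have hfac1 : (1 : ℝ) ≤ (n + 1).factorial := by exact_mod_cast (n + 1).factorial_pos
  have hqn : (1 : ℝ) ≤ (q : ℝ) ^ (n + 2) := one_le_pow₀ hq1
  have hexp : Real.exp (Real.log K + (n + 2) * Real.log q + (n + 1) * Real.log (n + 1)) =
      K * (q : ℝ) ^ (n + 2) * ((n : ℝ) + 1) ^ (n + 1) := by
    rw [Real.exp_add, Real.exp_add, Real.exp_log hK0]
    congr
    · rw [mul_comm, Real.exp_mul, Real.exp_log (by linarith)]
      exact_mod_cast Real.rpow_natCast (q : ℝ) (n + 2)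
    · rw [mul_comm, Real.exp_mul, Real.exp_log (by positivity)]
      exact_mod_cast Real.rpow_natCast ((n : ℝ) + 1) (n + 1)
  rw [hexp]
  suffices h : ‖χ.completedLFunction s‖ ≤ K * (q : ℝ) ^ (n + 2) * (n + 1).factorial from
    h.trans (mul_le_mul_of_nonneg_left hfac (by positivity))
  have hre := abs_le.mp ((abs_re_le_norm s).trans hs.le)
  have hr0 := norm_nonneg χ.rootNumber
  rcases le_total 2 s.re with h2 | h2
  · calc ‖χ.completedLFunction s‖ ≤ C * 1 * (n + 1).factorial := by
          rw [mul_one]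
          exact hC (n + 1) s h2 (by push_cast; linarith)
      _ ≤ _ := by
          gcongr
          rw [hK]; nlinarith [abs_nonneg D]
  rcases le_total (-1) s.re with h1 | h1
  · calc ‖χ.completedLFunction s‖ ≤ |D| * 1 * 1 := by
          simpa using (hD s h1 h2).trans (le_abs_self D)
      _ ≤ _ := by
          gcongr
          rw [hK]; nlinarith [abs_nonneg D]
  -- The reflected point `1 - s` has real part at least `2` and norm at most `n + 1`.
  · have hfe := hprim.completedLFunction_one_sub (1 - s)
    rw [sub_sub_cancel] at hfe
    rw [hfe, norm_mul, norm_mul]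
    have hpow : ‖(q : ℂ) ^ (1 - s - 1 / 2)‖ ≤ (q : ℝ) ^ (n + 2) := by
      rw [norm_natCast_cpow_of_pos (NeZero.pos q), ← Real.rpow_natCast]
      refine Real.rpow_le_rpow_of_exponent_le hq1 ?_
      simp
      linarith
    have h3 := hC' (n + 1) (1 - s) (by simp; linarith) (by
      have := norm_sub_le 1 s
      rw [norm_one] at this
      push_cast; linarith)
    calc _ ≤ (q : ℝ) ^ (n + 2) * ‖χ.rootNumber‖ * (C' * (n + 1).factorial) := by gcongr
      _ = ‖χ.rootNumber‖ * C' * (q : ℝ) ^ (n + 2) * (n + 1).factorial := by ring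
      _ ≤ _ := by
          gcongr
          rw [hK]; linarith [abs_nonneg D]

/-- The completed `L`-function of a real primitive character is zero-free if `L(s, χ)` has no
zero in the right half-plane. -/
lemma IsPrimitive.completedLFunction_ne_zero (hprim : χ.IsPrimitive) (hreal : χ.IsReal)
    (h : ∀ s : ℂ, 0 < s.re → χ.LFunction s ≠ 0) (s : ℂ) : χ.completedLFunction s ≠ 0 := by
  have hpos : ∀ s : ℂ, 0 < s.re → χ.completedLFunction s ≠ 0 := fun s hs => by
    obtain ⟨δ, -, hδ⟩ := exists_gammaFactor_eq χ
    rw [completedLFunction_eq_mul χ hs, hδ]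
    exact mul_ne_zero (h s hs) (Gammaℝ_ne_zero_of_re_pos (by simp; positivity))
  have hfe := hprim.completedLFunction_one_sub
  rw [hreal.inv_eq] at hfe
  -- At `0` the functional equation makes the nonzero value at `1` a multiple of the root number.
  have hroot : χ.rootNumber ≠ 0 := fun h0 => hpos 1 (by simp) (by simpa [h0] using hfe 0)
  rcases lt_or_ge 0 s.re with hs | hs
  · exact hpos s hs
  · rw [← sub_sub_cancel 1 s, hfe]
    refine mul_ne_zero (mul_ne_zero ?_ hroot) (hpos _ (by simp; linarith))
    simp [cpow_eq_zero_iff, NeZero.ne q]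

lemma tendsto_LFunction_atTop (χ : DirichletCharacter ℂ q) :
    Tendsto (fun x : ℝ => χ.LFunction x) atTop (𝓝 1) := by
  have h := LSeries.tendsto_atTop (f := (χ ·)) (lt_of_le_of_lt
    (LSeriesSummable_of_one_lt_re χ (s := 2) (by simp)).abscissaOfAbsConv_le (by simp))
  simp only [Nat.cast_one, map_one] at h
  refine h.congr' ?_
  filter_upwards [eventually_gt_atTop 1] with x hx
  rw [LFunction_eq_LSeries χ (by simpa using hx)]

/-- The `L`-function of a real primitive character of conductor `q ≠ 1` has a zero in the right
half-plane. -/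
theorem IsPrimitive.exists_LFunction_eq_zero (hprim : χ.IsPrimitive) (hreal : χ.IsReal)
    (hq : q ≠ 1) : ∃ ρ : ℂ, 0 < ρ.re ∧ χ.LFunction ρ = 0 := by
  by_contra! hne
  obtain ⟨A, hA⟩ := hprim.exists_norm_completedLFunction_le_exp hq
  obtain ⟨a, b, hab⟩ := eq_exp_affine_of_growth
    (differentiable_completedLFunction (hprim.ne_one hq))
    (hprim.completedLFunction_ne_zero hreal hne) hA (tendsto_mul_log_div_sq A (Real.log q))
  obtain ⟨δ, hδ1, hδ⟩ := exists_gammaFactor_eq χ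
  have hδ' : (δ : ℝ) ≤ 1 := by exact_mod_cast hδ1
  -- At these sample points the Gamma factor is `Gammaℝ (2 (m + 1))`, of norm `m! / π ^ (m + 1)`,
  -- whatever the parity of `χ`.
  have hx : Tendsto (fun m : ℕ => 2 * ((m : ℝ) + 1) - δ) atTop atTop :=
    tendsto_atTop_add_const_right _ _ ((tendsto_atTop_add_const_right _ 1
      tendsto_natCast_atTop_atTop).const_mul_atTop two_pos)
  have h1 := ((tendsto_LFunction_atTop χ).comp hx).norm
  set X := Real.pi * Real.exp (2 * ‖b‖) with hX
  have hle : ∀ m : ℕ, ‖χ.LFunction ((2 * ((m : ℝ) + 1) - δ : ℝ) : ℂ)‖ ≤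
      Real.exp ‖a‖ * X * (X ^ m / m.factorial) := by
    intro m
    set s : ℂ := ((2 * ((m : ℝ) + 1) - δ : ℝ) : ℂ) with hs
    have hm : (0 : ℝ) ≤ m := m.cast_nonneg
    have hsre : 0 < s.re := by rw [hs, ofReal_re]; linarith
    have hsn : ‖s‖ ≤ 2 * (m + 1) := by
      rw [hs, norm_real, Real.norm_of_nonneg (by linarith)]
      linarith [(Nat.cast_nonneg δ : (0 : ℝ) ≤ δ)]
    have heq := congrArg norm (completedLFunction_eq_mul χ hsre)
    have hsδ : s + δ = 2 * (m + 1) := by rw [hs]; push_cast; ring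
    rw [hab, norm_mul, hδ, hsδ, norm_Gammaℝ_two_mul_nat_add_one, norm_exp] at heq
    have hup : Real.exp (a + b * s).re ≤ Real.exp ‖a‖ * Real.exp (2 * ‖b‖) ^ (m + 1) := by
      rw [← Real.exp_nat_mul, ← Real.exp_add, Real.exp_le_exp]
      refine (re_le_norm _).trans ((norm_add_le _ _).trans ?_)
      rw [norm_mul]
      push_cast
      nlinarith [norm_nonneg b]
    rw [heq, ← mul_div_assoc, div_le_iff₀ (by positivity)] at hup
    rw [← mul_div_assoc, le_div_iff₀ (by positivity)]
    refine hup.trans (le_of_eq ?_)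
    rw [hX]
    ring
  have h0 := ((FloorSemiring.tendsto_pow_div_factorial_atTop X).const_mul (Real.exp ‖a‖ * X))
  have := le_of_tendsto_of_tendsto' h1 h0 hle
  simp at this
  linarith

/-- If `L(s, χ)` does not vanish on `(0, 1)`, its zeros in the right half-plane are nonreal. -/
lemma IsPrimitive.im_ne_zero_of_LFunction_eq_zero (hprim : χ.IsPrimitive) (hq : q ≠ 1)
    (hL : ∀ s : ℝ, 0 < s → s < 1 → χ.LFunction (s : ℂ) ≠ 0) {ρ : ℂ} (h0 : 0 < ρ.re)
    (hρ : χ.LFunction ρ = 0) : ρ.im ≠ 0 := by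
  intro him
  have h1 : ρ.re < 1 := not_le.mp fun h =>
    LFunction_ne_zero_of_one_le_re χ (.inl (hprim.ne_one hq)) h hρ
  have : ((ρ.re : ℝ) : ℂ) = ρ := Complex.ext rfl (by simp [him])
  exact hL ρ.re h0 h1 (by rwa [this])

end DirichletCharacter

end NonrealZero

/-! ### Sign changes of high derivatives of `f' / f` -/

section SignChanges

open Filter Topology Complex ComplexConjugate

/-- An entire function that is not identically zero is `(z - ρ) ^ m` times an entire function not
vanishing at `ρ`. -/
lemma Complex.exists_eq_pow_mul_entire {f : ℂ → ℂ} (hf : Differentiable ℂ f)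
    (hne : ∃ w, f w ≠ 0) (ρ : ℂ) :
    ∃ (m : ℕ) (g : ℂ → ℂ), Differentiable ℂ g ∧ g ρ ≠ 0 ∧ ∀ z, f z = (z - ρ) ^ m * g z := by
  have han : AnalyticOnNhd ℂ f Set.univ := fun z _ => hf.analyticAt z
  have hnz : ¬ ∀ᶠ z in 𝓝 ρ, f z = 0 := fun h => by
    obtain ⟨w, hw⟩ := hne
    exact hw (han.eqOn_zero_of_preconnected_of_eventuallyEq_zero isPreconnected_univ
      (Set.mem_univ ρ) h (Set.mem_univ w))
  obtain ⟨m, g, hg, hgρ, hfg⟩ := (hf.analyticAt ρ).exists_eventuallyEq_pow_smul_nonzero_iff.mpr hnz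
  classical
  set G : ℂ → ℂ := Function.update (fun z => f z / (z - ρ) ^ m) ρ (g ρ) with hG
  have hGρ : G =ᶠ[𝓝 ρ] g := by
    filter_upwards [hfg] with z hz
    rcases eq_or_ne z ρ with rfl | h
    · simp [hG]
    · have : (z - ρ) ^ m ≠ 0 := pow_ne_zero _ (sub_ne_zero.mpr h)
      rw [hG, Function.update_of_ne h, hz, smul_eq_mul, mul_div_cancel_left₀ _ this]
  refine ⟨m, G, fun z => ?_, by simpa [hG] using hgρ, fun z => ?_⟩
  · rcases eq_or_ne z ρ with rfl | h
    · exact hGρ.differentiableAt_iff.mpr hg.differentiableAt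
    · have : G =ᶠ[𝓝 z] fun z => f z / (z - ρ) ^ m := by
        filter_upwards [isOpen_ne.mem_nhds h] with w hw
        rw [hG, Function.update_of_ne hw]
      refine this.differentiableAt_iff.mpr ((hf z).div (by fun_prop) ?_)
      exact pow_ne_zero _ (sub_ne_zero.mpr h)
  · rcases eq_or_ne z ρ with rfl | h
    · rw [hfg.self_of_nhds, smul_eq_mul, hGρ.self_of_nhds]
    · rw [hG, Function.update_of_ne h, mul_div_cancel₀ _ (pow_ne_zero _ (sub_ne_zero.mpr h))]

/-- Partial fraction decomposition of `f' / f` near a disc on which `f` has no zeros besides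
`a` and `b`. -/
lemma Complex.exists_deriv_div_eq {f : ℂ → ℂ} (hf : Differentiable ℂ f) (hne : ∃ w, f w ≠ 0)
    {a b : ℂ} (hab : a ≠ b) (ha : f a = 0) {K : Set ℂ}
    (hK : ∀ z ∈ K, f z = 0 → z = a ∨ z = b) :
    ∃ (m n : ℕ) (g : ℂ → ℂ), 1 ≤ m ∧ (∀ z ∈ K, AnalyticAt ℂ g z) ∧
      ∀ z ∈ K, f z ≠ 0 → deriv f z / f z = m * (z - a)⁻¹ + n * (z - b)⁻¹ + g z := by
  obtain ⟨m, g, hg, hga, hfg⟩ := exists_eq_pow_mul_entire hf hne a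
  obtain ⟨n, h, hh, hhb, hgh⟩ := exists_eq_pow_mul_entire hg ⟨a, hga⟩ b
  have hfac : ∀ z, f z = (z - a) ^ m * ((z - b) ^ n * h z) := fun z => by rw [hfg, hgh]
  -- Only `a` is known to be a zero; the multiplicity at `b` may be `0`.
  have hm : 1 ≤ m := by
    by_contra! h0
    obtain rfl : m = 0 := by omega
    exact hga (by simpa [ha] using (hfg a).symm)
  have hha : h a ≠ 0 := fun h0 => hga (by rw [hgh, h0, mul_zero])
  have hhK : ∀ z ∈ K, h z ≠ 0 := fun z hz h0 => by
    rcases hK z hz (by rw [hfac, h0]; simp) with rfl | rfl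
    · exact hha h0
    · exact hhb h0
  refine ⟨m, n, fun z => deriv h z / h z, hm, fun z hz =>
    (hh.analyticAt z).deriv.div (hh.analyticAt z) (hhK z hz), fun z hz hfz => ?_⟩
  have h1 : z - a ≠ 0 ∨ m = 0 := by
    by_contra! h0
    exact hfz (by rw [hfac, h0.1, zero_pow h0.2, zero_mul])
  have h1' : z - a ≠ 0 := h1.resolve_right (by omega)
  have hpow : ∀ (c : ℂ) (k : ℕ), (z - c ≠ 0 ∨ k = 0) →
      HasDerivAt (fun z => (z - c) ^ k) ((z - c) ^ k * (k * (z - c)⁻¹)) z := fun c k hc => by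
    refine ((hasDerivAt_id z).sub_const c |>.pow k).congr_deriv ?_
    rcases k with _ | k
    · simp
    · have := hc.resolve_right (by omega)
      simp only [id_eq, Nat.add_sub_cancel, mul_one, pow_succ]
      field_simp
  have h2 : z - b ≠ 0 ∨ n = 0 := by
    by_contra! h0
    exact hfz (by rw [hfac, h0.1, zero_pow h0.2, zero_mul, mul_zero])
  have hd := (hpow a m h1).mul ((hpow b n h2).mul (hh z).hasDerivAt)
  rw [(hd.congr_of_eventuallyEq (.of_forall hfac)).deriv, div_eq_iff hfz, hfac z]
  simp only [Pi.mul_apply]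
  have hz := hhK z hz
  linear_combination -((z - a) ^ m * ((z - b) ^ n * (div_mul_cancel₀ (deriv h z) hz)))

lemma Complex.iteratedDeriv_inv_sub_const (n : ℕ) (a z : ℂ) :
    iteratedDeriv n (fun z => (z - a)⁻¹) z = (-1) ^ n * n.factorial * ((z - a)⁻¹) ^ (n + 1) := by
  have h := congrFun (iter_deriv_inv_linear_sub (𝕜 := ℂ) n 1 a) z
  simp only [one_mul, one_pow, mul_one] at h
  rw [iteratedDeriv_eq_iterate, h, inv_pow, ← zpow_natCast _ (n + 1), ← zpow_neg]
  congr 2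
  push_cast
  ring

/-- Inversion negates the argument, which the even cosine does not see. -/
lemma Complex.re_inv_pow (w : ℂ) (n : ℕ) :
    ((w⁻¹) ^ n).re = (‖w‖⁻¹) ^ n * Real.cos (n * w.arg) := by
  have h : (w⁻¹) ^ n = ((‖w‖⁻¹) ^ n : ℝ) * exp ((-(n * w.arg) : ℝ) * I) := by
    conv_lhs => rw [← norm_mul_exp_arg_mul_I w]
    rw [mul_inv, mul_pow, ← exp_neg, ← exp_nat_mul]
    push_cast
    congr 2
    ring
  rw [h, re_ofReal_mul, exp_ofReal_mul_I_re, Real.cos_neg]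

/-- If `θ` is not constant, `cos (n θ)` takes the values `1` and `-1` for all large `n`. -/
lemma eventually_exists_cos_natCast_mul_eq {θ : ℝ → ℝ} {a b : ℝ} (hab : a ≤ b)
    (hθ : ContinuousOn θ (Set.Icc a b)) (hne : θ a ≠ θ b) :
    ∀ᶠ n : ℕ in atTop, (∃ x ∈ Set.Icc a b, Real.cos (n * θ x) = 1) ∧
      ∃ x ∈ Set.Icc a b, Real.cos (n * θ x) = -1 := by
  have hsub : Set.uIcc (θ a) (θ b) ⊆ θ '' Set.Icc a b := by
    have := intermediate_value_uIcc (by rwa [Set.uIcc_of_le hab])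
    rwa [Set.uIcc_of_le hab] at this
  set α := min (θ a) (θ b) with hα
  set β := max (θ a) (θ b) with hβ
  have hαβ : 0 < β - α := by
    rw [hα, hβ, max_sub_min_eq_abs']
    exact abs_pos.mpr (sub_ne_zero.mpr hne)
  have hlarge : Tendsto (fun n : ℕ => (n : ℝ) * (β - α)) atTop atTop :=
    tendsto_natCast_atTop_atTop.atTop_mul_const hαβ
  filter_upwards [hlarge.eventually_ge_atTop (4 * Real.pi), eventually_ge_atTop 1] with n hn hn1
  have hn0 : (0 : ℝ) < n := by exact_mod_cast hn1
  have hpi := Real.pi_pos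
  have key : ∀ t, n * α ≤ t → t ≤ n * β → ∃ x ∈ Set.Icc a b, n * θ x = t := fun t h1 h2 => by
    obtain ⟨x, hx, hxt⟩ := hsub (show t / n ∈ Set.uIcc (θ a) (θ b) from
      ⟨by rw [le_div_iff₀ hn0]; linarith, by rw [div_le_iff₀ hn0]; linarith⟩)
    exact ⟨x, hx, by rw [hxt]; field_simp⟩
  -- The first multiple `2πj` past `nα` and the point `2πj + π` both lie below `nα + 3π`, hence in
  -- the range of `n θ`, whose length is at least `4π`.
  set j := ⌈n * α / (2 * Real.pi)⌉ with hj
  have h1 : n * α ≤ j * (2 * Real.pi) := by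
    rw [← div_le_iff₀ (by positivity)]
    exact Int.le_ceil _
  have h2 : (j : ℝ) * (2 * Real.pi) ≤ n * α + 2 * Real.pi := by
    have := (Int.ceil_lt_add_one (n * α / (2 * Real.pi))).le
    calc (j : ℝ) * (2 * Real.pi) ≤ (n * α / (2 * Real.pi) + 1) * (2 * Real.pi) := by gcongr
      _ = _ := by field_simp
  constructor
  · obtain ⟨x, hx, hxt⟩ := key (j * (2 * Real.pi)) h1 (by linarith)
    exact ⟨x, hx, by rw [hxt, Real.cos_int_mul_two_pi]⟩
  · obtain ⟨x, hx, hxt⟩ := key (j * (2 * Real.pi) + Real.pi) (by linarith) (by linarith)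
    exact ⟨x, hx, by rw [hxt, Real.cos_int_mul_two_pi_add_pi]⟩

/-- If the zeros of the entire function `f` nearest to the real point `x₀` are a nonreal `ρ` and
possibly its conjugate, then the real parts of the high derivatives of `f' / f` change sign next
to `x₀`. -/
theorem Complex.exists_re_iteratedDeriv_pos_neg {f : ℂ → ℂ} (hf : Differentiable ℂ f)
    (hne : ∃ w, f w ≠ 0) {ρ : ℂ} (hρ : f ρ = 0) (him : ρ.im ≠ 0) {x₀ R ε : ℝ}
    (hR : dist (x₀ : ℂ) ρ < R)
    (hz : ∀ z ∈ Metric.closedBall (x₀ : ℂ) R, f z = 0 → z = ρ ∨ z = conj ρ) (hε : 0 < ε) :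
    ∃ n : ℕ, (∃ x ∈ Set.Ico x₀ (x₀ + ε),
        0 < (iteratedDeriv n (fun z => deriv f z / f z) x).re) ∧
      ∃ x ∈ Set.Ico x₀ (x₀ + ε), (iteratedDeriv n (fun z => deriv f z / f z) x).re < 0 := by
  set d := dist (x₀ : ℂ) ρ with hd
  have hd0 : 0 < d := dist_pos.mpr fun h => him (by rw [← h, ofReal_im])
  -- The gap `3η < R - d` ensures `d + η < R - η = r`: on the short interval `ρ` stays closer than
  -- the radius used in Cauchy's estimate for the remainder.
  obtain ⟨η, hη0, hηε, hηR⟩ : ∃ η > 0, η < ε ∧ 3 * η < R - d :=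
    ⟨min (ε / 2) ((R - d) / 4), lt_min (by linarith) (by linarith),
      (min_le_left _ _).trans_lt (by linarith),
      by linarith [min_le_right (ε / 2) ((R - d) / 4)]⟩
  have hconj : ρ ≠ conj ρ := fun h => him (conj_eq_iff_im.mp h.symm)
  obtain ⟨m, m', g, hm, hgan, hfg⟩ := exists_deriv_div_eq hf hne hconj hρ hz
  obtain ⟨C, hC⟩ := (isCompact_closedBall (x₀ : ℂ) R).exists_bound_of_continuousOn
    fun z hz => (hgan z hz).continuousAt.continuousWithinAt
  set r := R - η with hr
  have hr0 : 0 < r := by linarith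
  -- the main term and the remainder
  have hmain : ∀ n : ℕ, ∀ x ∈ Set.Icc x₀ (x₀ + η), ∃ e : ℝ, |e| ≤ n.factorial * C / r ^ n ∧
      (iteratedDeriv n (fun z => deriv f z / f z) x).re = (-1) ^ n * n.factorial * (m + m') *
        ((‖(x : ℂ) - ρ‖⁻¹) ^ (n + 1) * Real.cos ((n + 1 : ℕ) * ((x : ℂ) - ρ).arg)) + e := by
    intro n x hx
    have hxx : dist (x : ℂ) x₀ ≤ η := by
      rw [dist_eq_norm, ← ofReal_sub, norm_real, Real.norm_of_nonneg (by linarith [hx.1])]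
      linarith [hx.2]
    have hsub : Metric.closedBall (x : ℂ) r ⊆ Metric.closedBall (x₀ : ℂ) R :=
      Metric.closedBall_subset_closedBall' (by linarith)
    have hxK : (x : ℂ) ∈ Metric.ball (x₀ : ℂ) R := Metric.mem_ball.mpr (by linarith)
    have hfx : f x ≠ 0 := fun h0 => by
      rcases hz x (Metric.ball_subset_closedBall hxK) h0 with h | h
      · exact him (by rw [← h, ofReal_im])
      · exact him (by simpa using congrArg im h)
    have heq : (fun z => deriv f z / f z) =ᶠ[𝓝 (x : ℂ)]
        fun z => (m * (z - ρ)⁻¹ + m' * (z - conj ρ)⁻¹) + g z := by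
      filter_upwards [Metric.isOpen_ball.mem_nhds hxK,
        (hf x).continuousAt.eventually_ne hfx] with z hz1 hz2
      exact hfg z (Metric.ball_subset_closedBall hz1) hz2
    have hgx : AnalyticAt ℂ g x := hgan x (Metric.ball_subset_closedBall hxK)
    have hs : ∀ c : ℂ, c.im ≠ 0 → AnalyticAt ℂ (fun z => (z - c)⁻¹) x := fun c hc =>
      (by fun_prop : AnalyticAt ℂ (fun z => z - c) x).inv fun h => hc (by
        rw [← sub_eq_zero.mp h, ofReal_im])
    have h1 := hs ρ him
    have h2 := hs (conj ρ) (by simpa using him)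
    refine ⟨(iteratedDeriv n g x).re, (abs_re_le_norm _).trans ?_, ?_⟩
    · refine norm_iteratedDeriv_le_of_forall_mem_sphere_norm_le n hr0 ?_ fun z hz =>
        hC z (hsub (Metric.sphere_subset_closedBall hz))
      refine DifferentiableOn.diffContOnCl_ball (U := Metric.closedBall (x₀ : ℂ) R)
        (fun z hz => (hgan z hz).differentiableAt.differentiableWithinAt) hsub
    · have h1' : ContDiffAt ℂ n (fun z => m * (z - ρ)⁻¹) x := contDiffAt_const.mul h1.contDiffAt
      have h2' : ContDiffAt ℂ n (fun z => m' * (z - conj ρ)⁻¹) x :=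
        contDiffAt_const.mul h2.contDiffAt
      have h12 : ContDiffAt ℂ n (fun z => m * (z - ρ)⁻¹ + m' * (z - conj ρ)⁻¹) x := h1'.add h2'
      rw [heq.iteratedDeriv_eq n, iteratedDeriv_fun_add h12 hgx.contDiffAt,
        iteratedDeriv_fun_add h1' h2',
        iteratedDeriv_const_mul_field, iteratedDeriv_const_mul_field,
        iteratedDeriv_inv_sub_const, iteratedDeriv_inv_sub_const, add_re, ← re_inv_pow]
      -- For real `x` the term of `conj ρ` is conjugate to that of `ρ`; the real parts agree, so the
      -- multiplicities add and nothing cancels.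
      have hc : (((x : ℂ) - conj ρ)⁻¹) ^ (n + 1) = conj ((((x : ℂ) - ρ)⁻¹) ^ (n + 1)) := by simp
      rw [hc]
      set w := (((x : ℂ) - ρ)⁻¹) ^ (n + 1)
      have hreal : ((m : ℂ) * ((-1) ^ n * n.factorial * w) +
          m' * ((-1) ^ n * n.factorial * conj w)) =
          (((m : ℝ) * ((-1) ^ n * n.factorial) : ℝ) : ℂ) * w +
          (((m' : ℝ) * ((-1) ^ n * n.factorial) : ℝ) : ℂ) * conj w := by push_cast; ring
      rw [hreal, add_re, re_ofReal_mul, re_ofReal_mul, conj_re]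
      ring
  -- the argument is not constant
  have hslit : ∀ x : ℝ, (x : ℂ) - ρ ∈ slitPlane := fun x => .inr (by simpa using him)
  have hθc : ContinuousOn (fun x : ℝ => ((x : ℂ) - ρ).arg) (Set.Icc x₀ (x₀ + η)) := fun x _ =>
    ((continuousAt_arg (hslit x)).comp
      (f := fun x : ℝ => (x : ℂ) - ρ) (by fun_prop)).continuousWithinAt
  have hθne : ((x₀ : ℂ) - ρ).arg ≠ (((x₀ + η : ℝ) : ℂ) - ρ).arg := by
    rw [Ne, arg_eq_arg_iff (slitPlane_ne_zero (hslit _)) (slitPlane_ne_zero (hslit _))]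
    intro h
    rw [← ofReal_div] at h
    have h1 := congrArg im h
    have h2 := congrArg re h
    rw [im_ofReal_mul] at h1
    rw [re_ofReal_mul] at h2
    simp only [sub_im, ofReal_im, zero_sub, sub_re, ofReal_re] at h1 h2
    -- Equal arguments mean proportional vectors; their common nonzero imaginary part forces the
    -- ratio `1`.
    have h3 : ‖((x₀ + η : ℝ) : ℂ) - ρ‖ / ‖(x₀ : ℂ) - ρ‖ = 1 :=
      mul_right_cancel₀ (neg_ne_zero.mpr him) (by rw [h1, one_mul])
    rw [h3] at h2
    linarith
  -- Shifted by one: `n` derivatives of a simple pole give the power `n + 1`.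
  have hcos := (tendsto_add_atTop_nat 1).eventually
    (eventually_exists_cos_natCast_mul_eq (by linarith) hθc hθne)
  have hratio : Tendsto (fun n : ℕ => (d + η) * C * ((d + η) / r) ^ n) atTop (𝓝 0) := by
    have := (tendsto_pow_atTop_nhds_zero_of_lt_one (r := (d + η) / r) (by positivity)
      (by rw [div_lt_one hr0]; linarith)).const_mul ((d + η) * C)
    simpa using this
  obtain ⟨n, ⟨⟨x, hx, hxc⟩, ⟨y, hy, hyc⟩⟩, hn⟩ :=
    (hcos.and (hratio.eventually_lt_const one_pos)).exists
  have hdom : ∀ x ∈ Set.Icc x₀ (x₀ + η), (n.factorial * C / r ^ n : ℝ) <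
      n.factorial * (m + m') * (‖(x : ℂ) - ρ‖⁻¹) ^ (n + 1) := fun x hx => by
    have hxd : ‖(x : ℂ) - ρ‖ ≤ d + η := by
      rw [← dist_eq_norm]
      refine (dist_triangle _ (x₀ : ℂ) _).trans ?_
      have : dist (x : ℂ) x₀ ≤ η := by
        rw [dist_eq_norm, ← ofReal_sub, norm_real, Real.norm_of_nonneg (by linarith [hx.1])]
        linarith [hx.2]
      linarith
    have hx0 : 0 < ‖(x : ℂ) - ρ‖ := norm_pos_iff.mpr (slitPlane_ne_zero (hslit x))
    have hm1 : (1 : ℝ) ≤ m + m' := by exact_mod_cast (by omega : 1 ≤ m + m')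
    have hf0 : (0 : ℝ) < n.factorial := by exact_mod_cast n.factorial_pos
    have h1 : C / r ^ n < ((d + η)⁻¹) ^ (n + 1) := by
      rw [div_pow] at hn
      rw [inv_pow, ← one_div, lt_div_iff₀ (by positivity)]
      calc C / r ^ n * (d + η) ^ (n + 1) = (d + η) * C * ((d + η) ^ n / r ^ n) := by
            rw [pow_succ]; ring
        _ < 1 := hn
    have h2 : ((d + η)⁻¹) ^ (n + 1) ≤ (‖(x : ℂ) - ρ‖⁻¹) ^ (n + 1) :=
      pow_le_pow_left₀ (by positivity) (inv_anti₀ hx0 hxd) _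
    calc (n.factorial * C / r ^ n : ℝ) = n.factorial * (C / r ^ n) := by ring
      _ < n.factorial * (‖(x : ℂ) - ρ‖⁻¹) ^ (n + 1) := by gcongr; exact h1.trans_le h2
      _ ≤ n.factorial * (m + m') * (‖(x : ℂ) - ρ‖⁻¹) ^ (n + 1) := by
        gcongr
        exact le_mul_of_one_le_right hf0.le hm1
  have hmem : ∀ x ∈ Set.Icc x₀ (x₀ + η), x ∈ Set.Ico x₀ (x₀ + ε) := fun x hx =>
    ⟨hx.1, by linarith [hx.2]⟩
  obtain ⟨e, he, hxe⟩ := hmain n x hx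
  obtain ⟨e', he', hye⟩ := hmain n y hy
  rw [hxc] at hxe
  rw [hyc] at hye
  have hdx := hdom x hx
  have hdy := hdom y hy
  rcases Nat.even_or_odd n with hpar | hpar
  · rw [hpar.neg_one_pow] at hxe hye
    exact ⟨n, ⟨x, hmem x hx, by rw [hxe]; linarith [(abs_le.mp he).1]⟩,
      ⟨y, hmem y hy, by rw [hye]; linarith [(abs_le.mp he').2]⟩⟩
  · rw [hpar.neg_one_pow] at hxe hye
    exact ⟨n, ⟨y, hmem y hy, by rw [hye]; linarith [(abs_le.mp he').1]⟩,
      ⟨x, hmem x hx, by rw [hxe]; linarith [(abs_le.mp he).2]⟩⟩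

end SignChanges

/-! ### Nearest zeros and derivatives of `log L` -/

section LogDerivative

open Filter Topology Complex ComplexConjugate

lemma Complex.isClosed_isDiscrete_zeros {f : ℂ → ℂ} (hf : Differentiable ℂ f)
    (hne : ∃ w, f w ≠ 0) : IsClosed (f ⁻¹' {0}) ∧ IsDiscrete (f ⁻¹' {0}) := by
  obtain ⟨w, hw⟩ := hne
  have han : AnalyticOnNhd ℂ f Set.univ := fun z _ => hf.analyticAt z
  have h : (f ⁻¹' {0})ᶜ ∈ codiscrete ℂ :=
    han.preimage_zero_mem_codiscreteWithin (x := w) hw (Set.mem_univ w) isConnected_univ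
  simpa using mem_codiscrete'.mp h

/-- Outside a countable set, a real point has at most two nearest points, conjugate to each other,
in a given countable set. -/
lemma countable_setOf_dist_eq {Z : Set ℂ} (hZ : Z.Countable) :
    {t : ℝ | ∃ a ∈ Z, ∃ b ∈ Z, a ≠ b ∧ a ≠ conj b ∧ dist (t : ℂ) a = dist (t : ℂ) b}.Countable := by
  have hsub : {t : ℝ | ∃ a ∈ Z, ∃ b ∈ Z, a ≠ b ∧ a ≠ conj b ∧ dist (t : ℂ) a = dist (t : ℂ) b} ⊆
      ⋃ p ∈ Z ×ˢ Z, {t : ℝ | p.1 ≠ p.2 ∧ p.1 ≠ conj p.2 ∧ dist (t : ℂ) p.1 = dist (t : ℂ) p.2} := by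
    rintro t ⟨a, ha, b, hb, h⟩
    exact Set.mem_biUnion (Set.mk_mem_prod ha hb) h
  refine Set.Countable.mono hsub ((hZ.prod hZ).biUnion fun p _ => Set.Subsingleton.countable ?_)
  obtain ⟨a, b⟩ := p
  rintro s ⟨hab, habc, hs⟩ t ⟨-, -, ht⟩
  have key : ∀ x : ℝ, dist (x : ℂ) a = dist (x : ℂ) b →
      (x - a.re) ^ 2 + a.im ^ 2 = (x - b.re) ^ 2 + b.im ^ 2 := fun x hx => by
    have := congrArg (· ^ 2) hx
    simp only [dist_eq_norm, Complex.sq_norm, normSq_apply, sub_re, sub_im, ofReal_re, ofReal_im] at this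
    linarith
  have h1 := key s hs
  have h2 := key t ht
  -- The equidistance conditions differ by a linear equation, so two solutions force equal real
  -- parts, hence `a = b` or `a = conj b`.
  have h3 : (s - t) * (a.re - b.re) = 0 := by linear_combination (h2 - h1) / 2
  rcases mul_eq_zero.mp h3 with h | h
  · linarith
  · exfalso
    have hre : a.re = b.re := by linarith
    rw [hre] at h1
    have him : a.im ^ 2 = b.im ^ 2 := by linarith
    rcases sq_eq_sq_iff_eq_or_eq_neg.mp him with h | h
    · exact hab (Complex.ext hre h)
    · exact habc (Complex.ext (by simpa using hre) (by simpa using h))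

/-- In every interval there is a real point whose nearest zeros of `f` are a single `ρ`, up to
conjugation. -/
lemma Complex.exists_real_nearest_zero {f : ℂ → ℂ} (hf : Differentiable ℂ f)
    (hne : ∃ w, f w ≠ 0) {ρ₀ : ℂ} (hρ₀ : f ρ₀ = 0) {a b : ℝ} (hab : a < b) :
    ∃ x ∈ Set.Ioo a b, ∃ ρ, f ρ = 0 ∧ dist (x : ℂ) ρ ≤ dist (x : ℂ) ρ₀ ∧
      ∃ R, dist (x : ℂ) ρ < R ∧
        ∀ z ∈ Metric.closedBall (x : ℂ) R, f z = 0 → z = ρ ∨ z = conj ρ := by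
  obtain ⟨hcl, hdis⟩ := isClosed_isDiscrete_zeros hf hne
  have hZ : (f ⁻¹' {0}).Countable :=
    (HereditarilyLindelofSpace.isLindelof _).countable_of_isDiscrete hdis
  obtain ⟨x, hxB, hx⟩ := ((countable_setOf_dist_eq hZ).dense_compl ℝ).exists_mem_open isOpen_Ioo
    (Set.nonempty_Ioo.mpr hab)
  have hfin : ∀ r, (Metric.closedBall (x : ℂ) r ∩ f ⁻¹' {0}).Finite := fun r =>
    ((isCompact_closedBall _ _).inter_right hcl).finite (hdis.mono Set.inter_subset_right)
  obtain ⟨ρ, ⟨hρ, hρ0⟩, hmin⟩ := Set.exists_min_image _ (fun z => dist (x : ℂ) z)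
    (hfin (dist (x : ℂ) ρ₀)) ⟨ρ₀, by simp [dist_comm], hρ₀⟩
  have hρd : dist (x : ℂ) ρ ≤ dist (x : ℂ) ρ₀ := by rwa [Metric.mem_closedBall, dist_comm] at hρ
  refine ⟨x, hx, ρ, hρ0, hρd, ?_⟩
  have hfar : ∀ z, f z = 0 → z ≠ ρ → z ≠ conj ρ → dist (x : ℂ) ρ < dist (x : ℂ) z := by
    intro z hz h1 h2
    refine lt_of_le_of_ne ?_ fun h => hxB ⟨z, hz, ρ, hρ0, h1, h2, h.symm⟩
    by_cases hzb : dist (x : ℂ) z ≤ dist (x : ℂ) ρ₀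
    · exact hmin z ⟨by rwa [Metric.mem_closedBall, dist_comm], hz⟩
    · exact hρd.trans (not_le.mp hzb).le
  -- Truncating at distance `+ 1` leaves finitely many zeros, so some `R` fits below all the
  -- remaining distances.
  have hev : ∀ᶠ R in 𝓝[>] dist (x : ℂ) ρ,
      ∀ z ∈ Metric.closedBall (x : ℂ) (dist (x : ℂ) ρ + 1) ∩ f ⁻¹' {0},
        z ≠ ρ → z ≠ conj ρ → R < dist (x : ℂ) z := by
    rw [eventually_all_finite (hfin _)]
    intro z hz
    by_cases h : z ≠ ρ ∧ z ≠ conj ρ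
    · filter_upwards [nhdsWithin_le_nhds (eventually_lt_nhds (hfar z hz.2 h.1 h.2))] with R hR _ _
      exact hR
    · exact .of_forall fun R h1 h2 => absurd ⟨h1, h2⟩ h
  have hlt : ∀ᶠ R in 𝓝[>] dist (x : ℂ) ρ, R < dist (x : ℂ) ρ + 1 :=
    nhdsWithin_le_nhds (eventually_lt_nhds (lt_add_one _))
  obtain ⟨R, hR, hR1, hR2⟩ := (hev.and (eventually_mem_nhdsWithin.and hlt)).exists
  refine ⟨R, hR1, fun z hz hz0 => ?_⟩
  by_contra! h
  have := hR z ⟨Metric.closedBall_subset_closedBall hR2.le hz, hz0⟩ h.1 h.2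
  rw [Metric.mem_closedBall, dist_comm] at hz
  linarith

namespace DirichletCharacter
variable {q : ℕ} [NeZero q] {χ : DirichletCharacter ℂ q}

/-- Every term of the Dirichlet series is real. -/
lemma IsReal.LFunction_im (hreal : χ.IsReal) {x : ℝ} (hx : 1 < x) :
    (χ.LFunction x).im = 0 := by
  rw [LFunction_eq_LSeries χ (by simpa using hx), LSeries,
    im_tsum (LSeriesSummable_of_one_lt_re χ (by simpa using hx))]
  refine (tsum_congr fun n => ?_).trans tsum_zero
  rcases eq_or_ne n 0 with rfl | hn
  · simp
  · rw [LSeries.term_of_ne_zero hn, ← conj_eq_iff_im, map_div₀, conj_eq_iff_im.mpr (hreal n)]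
    congr 1
    rw [← ofReal_natCast, ← ofReal_cpow (Nat.cast_nonneg n), conj_ofReal]

lemma analyticAt_deriv_LFunction_div (hχ : χ ≠ 1) {s : ℂ} (hs : 1 < s.re) :
    AnalyticAt ℂ (fun z => deriv χ.LFunction z / χ.LFunction z) s := by
  have h := (differentiable_LFunction hχ).analyticAt s
  exact h.deriv.div h (LFunction_ne_zero_of_one_le_re χ (.inl hχ) hs.le)

/-- The derivatives of `log L(s, χ)` are the restrictions to the real axis of those of `L' / L`. -/
lemma IsReal.iteratedDeriv_logL (hreal : χ.IsReal) (hχ : χ ≠ 1) (n : ℕ) :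
    ∀ x : ℝ, 1 < x → iteratedDeriv (n + 1) χ.logL x =
      (iteratedDeriv n (fun z => deriv χ.LFunction z / χ.LFunction z) x).re := by
  induction n with
  | zero =>
    intro x hx
    have him := hreal.LFunction_im hx
    have hne : χ.LFunction x ≠ 0 :=
      LFunction_ne_zero_of_one_le_re χ (.inl hχ) (by simpa using hx.le)
    have hL : χ.LFunction x = (χ.realL x : ℂ) := Complex.ext rfl (by simp [him])
    have hd : HasDerivAt χ.realL (deriv χ.LFunction x).re x :=
      (differentiable_LFunction hχ x).hasDerivAt.real_of_complex
    have h0 : χ.realL x ≠ 0 := fun h => hne (by rw [hL, h, ofReal_zero])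
    have hlog : deriv χ.logL x = _ := (hd.log h0).deriv
    rw [iteratedDeriv_one, iteratedDeriv_zero, hlog, hL, div_ofReal_re]
  | succ n ih =>
    intro x hx
    have heq : iteratedDeriv (n + 1) χ.logL =ᶠ[𝓝 x] fun x : ℝ =>
        (iteratedDeriv n (fun z => deriv χ.LFunction z / χ.LFunction z) x).re := by
      filter_upwards [isOpen_Ioi.mem_nhds hx] with y hy using ih y hy
    have han := analyticAt_deriv_LFunction_div hχ (s := x) (by simpa using hx)
    have hn : AnalyticAt ℂ (iteratedDeriv n fun z => deriv χ.LFunction z / χ.LFunction z) x := by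
      rw [iteratedDeriv_eq_iterate]
      exact han.iterated_deriv n
    rw [iteratedDeriv_succ, heq.deriv_eq, iteratedDeriv_succ]
    exact hn.differentiableAt.hasDerivAt.real_of_complex.deriv

lemma IsReal.continuousOn_iteratedDeriv_logL (hreal : χ.IsReal) (hχ : χ ≠ 1) (n : ℕ) :
    ContinuousOn (iteratedDeriv (n + 1) χ.logL) (Set.Ioi 1) := by
  refine ContinuousOn.congr (f := fun x : ℝ =>
    (iteratedDeriv n (fun z => deriv χ.LFunction z / χ.LFunction z) x).re) ?_
    fun x hx => hreal.iteratedDeriv_logL hχ n x hx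
  intro x hx
  have hn : AnalyticAt ℂ (iteratedDeriv n fun z => deriv χ.LFunction z / χ.LFunction z) x := by
    rw [iteratedDeriv_eq_iterate]
    exact (analyticAt_deriv_LFunction_div hχ (by simpa using hx)).iterated_deriv n
  exact (continuous_re.continuousAt.comp (hn.continuousAt.comp
    (f := fun x : ℝ => (x : ℂ)) continuous_ofReal.continuousAt)).continuousWithinAt

/-- Far enough to the right, on every interval some derivative of `log L(s, χ)` takes both
signs. -/
theorem IsPrimitive.exists_iteratedDeriv_logL_pos_neg (hprim : χ.IsPrimitive) (hreal : χ.IsReal)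
    (hq : q ≠ 1) (hL : ∀ s : ℝ, 0 < s → s < 1 → χ.LFunction (s : ℂ) ≠ 0) :
    ∃ c : ℝ, 1 ≤ c ∧ ∀ a b : ℝ, c ≤ a → a < b → ∃ k : ℕ, 1 ≤ k ∧
      (∃ x ∈ Set.Ioo a b, 0 < iteratedDeriv k χ.logL x) ∧
      ∃ x ∈ Set.Ioo a b, iteratedDeriv k χ.logL x < 0 := by
  have hχ := hprim.ne_one hq
  have hd := differentiable_LFunction hχ
  have hne : ∃ w, χ.LFunction w ≠ 0 :=
    ⟨1, LFunction_ne_zero_of_one_le_re χ (.inl hχ) (by simp)⟩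
  obtain ⟨ρ₀, hre₀, hρ₀⟩ := hprim.exists_LFunction_eq_zero hreal hq
  -- For real `x`, `|x - ρ₀| < x` exactly when `x > |ρ₀|² / (2 Re ρ₀)`. Then any zero no farther
  -- from `x` than `ρ₀` has positive real part.
  refine ⟨max 1 ((ρ₀.re ^ 2 + ρ₀.im ^ 2) / (2 * ρ₀.re)), le_max_left _ _, fun a b hca hab => ?_⟩
  obtain ⟨h1a, hca⟩ := max_le_iff.mp hca
  obtain ⟨x, ⟨hax, hxb⟩, ρ, hρ, hρd, R, hR, hz⟩ := exists_real_nearest_zero hd hne hρ₀ hab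
  have hdx : dist (x : ℂ) ρ₀ < x := by
    rw [dist_eq_norm]
    refine lt_of_pow_lt_pow_left₀ 2 (by linarith) ?_
    rw [div_le_iff₀ (by positivity)] at hca
    simp only [Complex.sq_norm, normSq_apply, sub_re, sub_im, ofReal_re, ofReal_im]
    nlinarith
  have hre : 0 < ρ.re := by
    have h := (abs_re_le_norm ((x : ℂ) - ρ)).trans_lt
      (by rw [← dist_eq_norm]; exact hρd.trans_lt hdx)
    rw [sub_re, ofReal_re] at h
    linarith [le_abs_self (x - ρ.re)]
  obtain ⟨n, ⟨y, hy, hypos⟩, ⟨z, hz, hzneg⟩⟩ := exists_re_iteratedDeriv_pos_neg hd hne hρ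
    (hprim.im_ne_zero_of_LFunction_eq_zero hq hL hre hρ) hR hz (sub_pos.mpr hxb)
  rw [add_sub_cancel] at hy hz
  refine ⟨n + 1, by omega, ⟨y, ⟨by linarith [hy.1], hy.2⟩, ?_⟩, ⟨z, ⟨by linarith [hz.1], hz.2⟩, ?_⟩⟩
  · rwa [hreal.iteratedDeriv_logL hχ n y (by linarith [hy.1])]
  · rwa [hreal.iteratedDeriv_logL hχ n z (by linarith [hz.1])]

end DirichletCharacter

end LogDerivative

/-! ### Density of the zeros and failure of monotonicity -/

theorem theorem1 (q : ℕ) [NeZero q] (hq : q ≠ 1) (χ : DirichletCharacter ℂ q)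
    (hreal : χ.IsReal) (hprim : χ.IsPrimitive)
    (hL : ∀ s : ℝ, 0 < s → s < 1 → χ.LFunction (s : ℂ) ≠ 0) :
    ∃ c : ℝ, 1 ≤ c ∧
      Set.Ici c ⊆ closure (Set.Ici c ∩ ⋃ k : ℕ, ⋃ _ : 1 ≤ k, χ.logLDerivZeros k) ∧
      ∀ I : Set ℝ, I.OrdConnected → I.Nontrivial → I ⊆ Set.Ici c →
        ¬ LogCompletelyMonotonicOn χ.realL I := by
  obtain ⟨c, hc1, hc⟩ := hprim.exists_iteratedDeriv_logL_pos_neg hreal hq hL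
  refine ⟨c, hc1, fun s hs => ?_, fun I hI hnt hIc ⟨_, _, hmono⟩ => ?_⟩
  · refine Metric.mem_closure_iff.mpr fun ε hε => ?_
    obtain ⟨k, hk, ⟨x, hx, hxpos⟩, ⟨y, hy, hyneg⟩⟩ := hc s (s + ε) hs (by linarith)
    have hsub : Set.uIcc x y ⊆ Set.Ioo s (s + ε) :=
      Set.OrdConnected.uIcc_subset Set.ordConnected_Ioo hx hy
    have hs1 : 1 ≤ s := hc1.trans hs
    obtain ⟨n, rfl⟩ : ∃ n, k = n + 1 := ⟨k - 1, by omega⟩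
    have hcont : ContinuousOn (iteratedDeriv (n + 1) χ.logL) (Set.uIcc x y) :=
      (hreal.continuousOn_iteratedDeriv_logL (hprim.ne_one hq) n).mono fun t ht =>
        hs1.trans_lt (hsub ht).1
    obtain ⟨t, ht, ht0⟩ := intermediate_value_uIcc hcont
      (Set.mem_uIcc_of_ge hyneg.le hxpos.le)
    have hts := hsub ht
    refine ⟨t, ⟨le_trans hs hts.1.le, Set.mem_iUnion₂.mpr ⟨n + 1, hk, hs1.trans_lt hts.1, ht0⟩⟩, ?_⟩
    rw [Real.dist_eq, abs_sub_comm, abs_of_pos (sub_pos.mpr hts.1)]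
    linarith [hts.2]
  · obtain ⟨u, hu, v, hv, huv⟩ := hnt.exists_lt
    obtain ⟨k, hk, ⟨x, hx, hxpos⟩, ⟨y, hy, hyneg⟩⟩ := hc u v (hIc hu) huv
    -- `I` is a neighbourhood of each point of `(u, v)`, so derivatives within `I` are ordinary
    -- derivatives there.
    have hnhds : ∀ t ∈ Set.Ioo u v, I =ᶠ[nhds t] Set.univ := fun t ht =>
      Filter.eventuallyEq_univ.mpr (Filter.mem_of_superset (Icc_mem_nhds ht.1 ht.2) (hI.out hu hv))
    have hsign : ∀ t ∈ Set.Ioo u v, 0 ≤ (-1 : ℝ) ^ k * iteratedDeriv k χ.logL t := fun t ht => by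
      have h := hmono k hk t (hI.out hu hv (Set.Ioo_subset_Icc_self ht))
      rwa [iteratedDerivWithin_eq_iteratedFDerivWithin,
        iteratedFDerivWithin_congr_set (hnhds t ht) k,
        ← iteratedDerivWithin_eq_iteratedFDerivWithin, iteratedDerivWithin_univ] at h
    have hx' := hsign x hx
    have hy' := hsign y hy
    rcases Nat.even_or_odd k with hpar | hpar
    · rw [hpar.neg_one_pow] at hy'
      linarith
    · rw [hpar.neg_one_pow] at hx'
      linarith
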